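/- **Theorem 6.** Let $M$ be a compact connected smooth Riemannian manifold (without boundary), let $d$ be its Riemannian distance, and write $B(p,r)$ for the open $d$-ball. A $C^1$ local diffeomorphism $f:M\to M$ is called *expanding* if there are $\lambda>1$ and some Riemannian metric on $M$ with $\|Df(x)v\|\ge\lambda\|v\|$ for all $x\in M$, $v\in T_xM$. For $\sigma>1$ and $\rho>0$ let $\mathcal E(\sigma,\rho)$ be the set of expanding $C^1$ local diffeomorphisms $f:M\to M$ with expansion factor $\sigma$ and injectivity constant $\rho$, meaning that for every $p\in M$ the set $f(B(p,\rho))$ contains a neighborhood of the closure of $B(f(p),\rho)$, and $d(f(x),f(y))\ge\sigma\, d(x,y)$ for all $x,y\in B(p,\rho)$. Let $(M,\Phi)$ be a non-autonomous iterated function system (NAIFS), i.e. a sequence $\Phi^{(j)}=\{\varphi^{(j)}_i:M\to M\}_{i\in I^{(j)}}$, $j\ge1$, with each $I^{(j)}$ a finite non-empty index set. For $w=w_1w_2\ldots\in I^{1,\infty}:=\prod_{j\ge1}I^{(j)}$ put $\varphi_w^{1,0}=\mathrm{id}_M$ and $\varphi_w^{1,k}=\varphi^{(k)}_{w_k}\circ\cdots\circ\varphi^{(1)}_{w_1}$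 for $k\ge 1$. Suppose that $(M,\Phi)$ is uniformly expanding, i.e. that there are $\sigma>1$ and $\rho>0$ with $\varphi_i^{(j)}\in\mathcal E(\sigma,\rho)$ for all $j\ge1$ and $i\in I^{(j)}$. Then $(M,\Phi)$ satisfies the specification property: for every $\delta>0$ there is a positive integer $N=N(\delta)$ such that for every $w\in I^{1,\infty}$, every $s\ge2$, all $x_1,\dots,x_s\in M$ and all integers $0=j_1\le k_1<j_2\le k_2<\cdots<j_s\le k_s$ with $j_{m+1}-k_m\ge N$ for $m=1,\dots,s-1$, there is a point $x\in M$ with $$d\big(\varphi_w^{1,i}(x),\varphi_w^{1,i}(x_m)\big)\le\delta\qquad\text{for all }1\le m\le s\text{ and } j_m\le i\le k_m .$$ -/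

import Mathlib

open Set Metric
open scoped Manifold ContDiff Bundle Topology

universe u v

/-- A non-autonomous iterated function system on `X`: a sequence of finite non-empty families of
self-maps of `X`. The sequence is indexed from `0`, so that `map j` is the family `Φ^(j+1)` and
`index j` is its index set `I^(j+1)`. -/
structure NAIFS (X : Type u) where
  /-- The index sets. -/
  index : ℕ → Type v
  finite_index : ∀ j, Finite (index j)
  nonempty_index : ∀ j, Nonempty (index j)
  /-- The maps of the system. -/
  map : ∀ j, index j → X → X

namespace NAIFS

/-- The infinite words of the system, i.e. the elements of `I^(1,∞)`. -/
abbrev Word {X : Type u} (Φ : NAIFS.{u, v} X) : Type v := ∀ j, Φ.index j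

/-- The time evolution along the infinite word `w`: `Φ.iter w k` is the composition of the first
`k` maps selected by `w`, that is `φ_w^(1,k)`; it is the identity for `k = 0`. -/
def iter {X : Type u} (Φ : NAIFS.{u, v} X) (w : Φ.Word) : ℕ → X → X
  | 0 => id
  | k + 1 => Φ.map k (w k) ∘ iter Φ w k

/-- The specification property. The points `x 1, …, x s` and the times
`0 = j 1 ≤ k 1 < j 2 ≤ k 2 < ⋯ < j s ≤ k s` are given by sequences of which only the terms with
index in `{1, …, s}` matter. -/
def HasSpecification {X : Type u} [PseudoMetricSpace X] (Φ : NAIFS.{u, v} X) : Prop :=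
  ∀ δ : ℝ, 0 < δ → ∃ N : ℕ, 0 < N ∧
    ∀ (w : Φ.Word) (s : ℕ), 2 ≤ s → ∀ (x : ℕ → X) (j k : ℕ → ℕ),
      j 1 = 0 →
      (∀ m, 1 ≤ m → m ≤ s → j m ≤ k m) →
      (∀ m, 1 ≤ m → m < s → k m < j (m + 1)) →
      (∀ m, 1 ≤ m → m < s → k m + N ≤ j (m + 1)) →
      ∃ y : X, ∀ m, 1 ≤ m → m ≤ s → ∀ i, j m ≤ i → i ≤ k m →
        dist (Φ.iter w i y) (Φ.iter w i (x m)) ≤ δ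

end NAIFS

/-- A self-map `f` of a manifold is expanding if it is a `C^1` local diffeomorphism and there are
`σ > 1` and some smooth Riemannian metric for which `‖Df(x) v‖ ≥ σ ‖v‖` for every tangent
vector `v` at every point `x`. -/
def IsExpandingLocalDiffeo (n : ℕ) {M : Type u} [TopologicalSpace M]
    [ChartedSpace (EuclideanSpace ℝ (Fin n)) M] [IsManifold (𝓡 n) ∞ M] (f : M → M) : Prop :=
  IsLocalDiffeomorph (𝓡 n) (𝓡 n) 1 f ∧
    ∃ σ : ℝ, 1 < σ ∧
      ∃ g : Bundle.ContMDiffRiemannianMetric (𝓡 n) ∞ (EuclideanSpace ℝ (Fin n))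
          (fun x : M ↦ TangentSpace (𝓡 n) x),
        ∀ (x : M) (v : TangentSpace (𝓡 n) x),
          σ * √(g.inner x v v) ≤
            √(g.inner (f x) (mfderiv (𝓡 n) (𝓡 n) f x v) (mfderiv (𝓡 n) (𝓡 n) f x v))

/-- `f` has expansion factor `σ` and injectivity constant `ρ` with respect to the distance of `M`:
on each ball `B(p, ρ)` the map `f` expands distances by at least `σ`, and the image of `B(p, ρ)`
contains a neighborhood of the closure of `B(f p, ρ)`. -/
def HasExpansionConstants {M : Type u} [PseudoMetricSpace M] (f : M → M) (σ ρ : ℝ) : Prop :=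
  ∀ p : M, f '' ball p ρ ∈ 𝓝ˢ (closure (ball (f p) ρ)) ∧
    ∀ x ∈ ball p ρ, ∀ y ∈ ball p ρ, σ * dist x y ≤ dist (f x) (f y)

/-- The class `𝓔(σ, ρ)` of expanding `C^1` local diffeomorphisms of `M` with expansion factor `σ`
and injectivity constant `ρ`. -/
def ExpandingClass (n : ℕ) (M : Type u) [PseudoMetricSpace M]
    [ChartedSpace (EuclideanSpace ℝ (Fin n)) M] [IsManifold (𝓡 n) ∞ M] (σ ρ : ℝ) :
    Set (M → M) :=
  {f | IsExpandingLocalDiffeo n f ∧ HasExpansionConstants f σ ρ}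

/-- The system `(M, Φ)` is uniformly expanding with uniform expansion factor `σ > 1` and
injectivity constant `ρ > 0`: all its maps lie in `𝓔(σ, ρ)`. -/
def NAIFS.IsUniformlyExpanding (n : ℕ) {M : Type u} [PseudoMetricSpace M]
    [ChartedSpace (EuclideanSpace ℝ (Fin n)) M] [IsManifold (𝓡 n) ∞ M]
    (Φ : NAIFS.{u, v} M) (σ ρ : ℝ) : Prop :=
  1 < σ ∧ 0 < ρ ∧ ∀ (j : ℕ) (i : Φ.index j), Φ.map j i ∈ ExpandingClass n M σ ρ

/-! Only the metric constants matter. A point within `ρ` of `f p` has a preimage `σ` times closer to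
`p`, so orbits can be pulled back without losing accuracy, and over `k` steps the initial error
shrinks by `σ ^ k` (`exists_orbit_shadowing`). Moving the endpoint along a `ρ`-chain of bounded
length, one link per pullback, shows that long compositions map every `r`-ball onto the whole space,
uniformly in the maps (`exists_orbit_ending_at`). Segments are then glued from the last one
backwards, the gaps being bridged by this exactness. -/

/-- In a compact connected metric space, any two points are joined by an `ε`-chain whose number of
steps is bounded independently of the points. -/
theorem exists_uniform_chain_length {X : Type u} [PseudoMetricSpace X] [CompactSpace X]
    [ConnectedSpace X] {ε : ℝ} (hε : 0 < ε) :
    ∃ K : ℕ, ∀ a b : X, ∃ z : ℕ → X, z 0 = a ∧ z K = b ∧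
      ∀ l < K, dist (z (l + 1)) (z l) < ε := by
  obtain ⟨c⟩ : Nonempty X := inferInstance
  let R : ℕ → Set X := fun k => (thickening ε)^[k] {c}
  have hRs : ∀ k, R (k + 1) = thickening ε (R k) := fun k => Function.iterate_succ_apply' _ _ _
  have hmono : Monotone R := monotone_nat_of_le_succ fun k => by
    rw [hRs]; exact self_subset_thickening hε _
  have hopen : ∀ k, IsOpen (R (k + 1)) := fun k => by rw [hRs]; exact isOpen_thickening
  have hstep : ∀ k x y, x ∈ R k → dist y x < ε → y ∈ R (k + 1) := fun k x y hx h => by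
    rw [hRs]; exact mem_thickening_iff.2 ⟨x, hx, h⟩
  -- The indices are shifted because `R 0` is a singleton, which need not be open.
  have hcover : (⋃ k, R (k + 1)) = univ := by
    refine IsClopen.eq_univ ⟨?_, isOpen_iUnion hopen⟩ ⟨c, mem_iUnion.2 ⟨0, hmono (Nat.zero_le 1) rfl⟩⟩
    refine isClosed_of_closure_subset fun y hy => ?_
    obtain ⟨x, hx, hxy⟩ := Metric.mem_closure_iff.1 hy ε hε
    obtain ⟨k, hk⟩ := mem_iUnion.1 hx
    exact mem_iUnion.2 ⟨k + 1, hstep _ x y hk hxy⟩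
  obtain ⟨k, hk⟩ := isCompact_univ.elim_directed_cover (fun k => R (k + 1)) hopen hcover.ge
    (Monotone.directed_le fun i j h => hmono (by omega))
  have hchain : ∀ m, ∀ b ∈ R m, ∃ z : ℕ → X, z 0 = c ∧ z m = b ∧
      ∀ l < m, dist (z (l + 1)) (z l) < ε := by
    intro m
    induction m with
    | zero => exact fun b hb => ⟨fun _ => c, rfl, (mem_singleton_iff.1 hb).symm, by simp⟩
    | succ m ih =>
      intro b hb
      rw [hRs] at hb
      obtain ⟨x, hx, hbx⟩ := mem_thickening_iff.1 hb
      obtain ⟨z, h0, hm, hz⟩ := ih x hx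
      refine ⟨fun l => if l ≤ m then z l else b, by simp [h0], by simp, fun l hl => ?_⟩
      rcases Nat.lt_succ_iff_lt_or_eq.1 hl with h | rfl
      · simpa [h.le, Nat.succ_le_of_lt h] using hz l h
      · simpa [hm] using hbx
  -- Go from `a` back to the centre `c`, then out to `b`.
  refine ⟨(k + 1) + (k + 1), fun a b => ?_⟩
  obtain ⟨z, hz0, hzk, hz⟩ := hchain (k + 1) a (hk (mem_univ a))
  obtain ⟨z', hz0', hzk', hz'⟩ := hchain (k + 1) b (hk (mem_univ b))
  refine ⟨fun l => if l ≤ k + 1 then z (k + 1 - l) else z' (l - (k + 1)), by simp [hzk],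
    by simp [hzk'], fun l hl => ?_⟩
  rcases lt_or_ge l (k + 1) with h | h
  · have e : k + 1 - l = (k + 1 - (l + 1)) + 1 := by omega
    have h' := hz (k + 1 - (l + 1)) (by omega)
    rw [← e, dist_comm] at h'
    simpa only [if_pos h.le, if_pos (Nat.succ_le_of_lt h)] using h'
  · have e : l + 1 - (k + 1) = (l - (k + 1)) + 1 := by omega
    have h' := hz' (l - (k + 1)) (by omega)
    rw [← e] at h'
    have hzl : (if l ≤ k + 1 then z (k + 1 - l) else z' (l - (k + 1))) = z' (l - (k + 1)) := by
      split_ifs with hle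
      · obtain rfl : l = k + 1 := le_antisymm hle h
        simp [hz0, hz0']
      · rfl
    simpa only [hzl, if_neg (show ¬ l + 1 ≤ k + 1 by omega)] using h'

/-- Points near `f p` have preimages near `p`, closer by the expansion factor. -/
theorem HasExpansionConstants.exists_preimage {X : Type u} [PseudoMetricSpace X] {f : X → X}
    {σ ρ : ℝ} (hf : HasExpansionConstants f σ ρ) (hρ : 0 < ρ) {p z : X}
    (hz : dist z (f p) < ρ) : ∃ y, f y = z ∧ σ * dist y p ≤ dist z (f p) := by
  obtain ⟨hnhds, hexp⟩ := hf p
  obtain ⟨y, hy, rfl⟩ := subset_of_mem_nhdsSet hnhds (subset_closure (mem_ball.2 hz))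
  exact ⟨y, rfl, hexp y hy p (mem_ball_self hρ)⟩

/-- `o` is an orbit of the sequence of maps `f` between the times `a` and `b`. -/
def IsOrbitOn {X : Type u} (f : ℕ → X → X) (a b : ℕ) (o : ℕ → X) : Prop :=
  ∀ i, a ≤ i → i < b → o (i + 1) = f i (o i)

/-- An orbit can be pulled back from a point close to its end, along contracting inverse
branches. -/
theorem exists_orbit_shadowing {X : Type u} [PseudoMetricSpace X] {f : ℕ → X → X} {σ ρ : ℝ}
    (hσ : 1 < σ) (hρ : 0 < ρ) (hf : ∀ i, HasExpansionConstants (f i) σ ρ) (a k : ℕ)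
    {p : ℕ → X} (hp : IsOrbitOn f a (a + k) p) {z : X} (hz : dist z (p (a + k)) < ρ) :
    ∃ o, IsOrbitOn f a (a + k) o ∧ o (a + k) = z ∧
      (∀ i, a ≤ i → i ≤ a + k → dist (o i) (p i) ≤ dist z (p (a + k))) ∧
      σ ^ k * dist (o a) (p a) ≤ dist z (p (a + k)) := by
  induction k generalizing z with
  | zero =>
    refine ⟨fun _ => z, fun i h h' => by omega, rfl, fun i h h' => ?_, by simp⟩
    obtain rfl : i = a := by omega
    rfl
  | succ k ih =>
    have hpk : p (a + (k + 1)) = f (a + k) (p (a + k)) := hp (a + k) (by omega) (by omega)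
    rw [hpk] at hz ⊢
    obtain ⟨y, hy, hyd⟩ := (hf (a + k)).exists_preimage hρ hz
    have hle : dist y (p (a + k)) ≤ dist z (f (a + k) (p (a + k))) := by
      nlinarith [dist_nonneg (x := y) (y := p (a + k))]
    obtain ⟨o, ho, hok, hod, hoa⟩ := ih (fun i h h' => hp i h (by omega)) (hle.trans_lt hz)
    refine ⟨fun i => if i ≤ a + k then o i else z, fun i h h' => ?_, by simp, fun i h h' => ?_, ?_⟩
    · obtain h'' | rfl : i < a + k ∨ i = a + k := by omega
      · simpa [h'', h''.le] using ho i h h''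
      · simp [hok, hy]
    · by_cases hi : i ≤ a + k
      · simpa [hi] using (hod i h hi).trans hle
      · obtain rfl : i = a + (k + 1) := by omega
        simp [hpk]
    · have : σ * (σ ^ k * dist (o a) (p a)) ≤ σ * dist y (p (a + k)) := by gcongr
      simp only [Nat.le_add_right, if_true, pow_succ']
      linarith

/-- Orbits starting close to a given one reach every point in a uniformly bounded time. -/
theorem exists_orbit_ending_at {X : Type u} [PseudoMetricSpace X] [CompactSpace X]
    [ConnectedSpace X] {σ ρ r : ℝ} (hσ : 1 < σ) (hρ : 0 < ρ) (hr : 0 < r) :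
    ∃ N : ℕ, 0 < N ∧ ∀ f : ℕ → X → X, (∀ i, HasExpansionConstants (f i) σ ρ) →
      ∀ a k, N ≤ k → ∀ p : ℕ → X, IsOrbitOn f a (a + k) p → ∀ z : X,
        ∃ o, IsOrbitOn f a (a + k) o ∧ o (a + k) = z ∧ dist (o a) (p a) < r := by
  obtain ⟨K, hK⟩ := exists_uniform_chain_length (X := X) hρ
  obtain ⟨N, hN⟩ := pow_unbounded_of_one_lt (K * ρ / r) hσ
  refine ⟨N + 1, N.succ_pos, fun f hf a k hk p hp z => ?_⟩
  obtain ⟨c, hc0, hcK, hc⟩ := hK (p (a + k)) z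
  -- Each link is pulled back along the orbit obtained for the previous link, and costs at most `ρ /
  -- σ ^ k` at time `a`.
  have key : ∀ l ≤ K, ∃ o, IsOrbitOn f a (a + k) o ∧ o (a + k) = c l ∧
      σ ^ k * dist (o a) (p a) ≤ l * ρ := by
    intro l
    induction l with
    | zero => exact fun _ => ⟨p, hp, hc0.symm, by simp⟩
    | succ l ih =>
      intro hl
      obtain ⟨o, ho, hok, hoa⟩ := ih (by omega)
      have hd : dist (c (l + 1)) (o (a + k)) < ρ := by rw [hok]; exact hc l (by omega)
      obtain ⟨o', ho', hok', -, hoa'⟩ := exists_orbit_shadowing hσ hρ hf a k ho hd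
      refine ⟨o', ho', hok', ?_⟩
      have := mul_le_mul_of_nonneg_left (dist_triangle (o' a) (o a) (p a))
        (by positivity : 0 ≤ σ ^ k)
      push_cast
      linarith
  obtain ⟨o, ho, hok, hoa⟩ := key K le_rfl
  refine ⟨o, ho, hok.trans hcK, ?_⟩
  have h1 : K * ρ < σ ^ k * r := (div_lt_iff₀ hr).1
    (hN.trans_le (pow_le_pow_right₀ hσ.le (by omega)))
  exact lt_of_mul_lt_mul_left (hoa.trans_lt h1) (by positivity)

namespace NAIFS

theorem isOrbitOn_iter {X : Type u} (Φ : NAIFS.{u, v} X) (w : Φ.Word) (a b : ℕ) (x : X) :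
    IsOrbitOn (fun i => Φ.map i (w i)) a b (fun i => Φ.iter w i x) :=
  fun _ _ _ => rfl

theorem iter_eq_of_isOrbitOn {X : Type u} (Φ : NAIFS.{u, v} X) (w : Φ.Word) {a b : ℕ}
    {o : ℕ → X} (ho : IsOrbitOn (fun i => Φ.map i (w i)) a b o) {y : X}
    (hy : Φ.iter w a y = o a) {i : ℕ} (hai : a ≤ i) (hib : i ≤ b) : Φ.iter w i y = o i := by
  induction i, hai using Nat.le_induction with
  | base => exact hy
  | succ i hi ih =>
    rw [ho i hi (by omega), ← ih (by omega)]
    rfl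

/-- On a compact connected metric space, uniform expansion constants force the specification
property. -/
theorem hasSpecification_of_hasExpansionConstants {X : Type u} [PseudoMetricSpace X]
    [CompactSpace X] [ConnectedSpace X] (Φ : NAIFS.{u, v} X) {σ ρ : ℝ} (hσ : 1 < σ) (hρ : 0 < ρ)
    (hΦ : ∀ j i, HasExpansionConstants (Φ.map j i) σ ρ) : Φ.HasSpecification := by
  intro δ hδ
  obtain ⟨r, hr, hrδ, hrρ⟩ : ∃ r, 0 < r ∧ r ≤ δ ∧ r ≤ ρ :=
    ⟨min δ ρ, lt_min hδ hρ, min_le_left _ _, min_le_right _ _⟩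
  obtain ⟨N, hN, hexact⟩ := exists_orbit_ending_at (X := X) hσ hρ hr
  refine ⟨N, hN, fun w s hs x j k hj1 hjk _ hgap => ?_⟩
  have hf : ∀ i, HasExpansionConstants (Φ.map i (w i)) σ ρ := fun i => hΦ i (w i)
  have pullback : ∀ m, 1 ≤ m → m ≤ s → ∀ z, dist z (Φ.iter w (k m) (x m)) < r →
      ∃ o, IsOrbitOn (fun i => Φ.map i (w i)) (j m) (k m) o ∧ o (k m) = z ∧
        ∀ i, j m ≤ i → i ≤ k m → dist (o i) (Φ.iter w i (x m)) < r := by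
    intro m h1 hms z hz
    obtain ⟨d, hd⟩ := Nat.exists_eq_add_of_le (hjk m h1 hms)
    rw [hd] at hz ⊢
    obtain ⟨o, ho, hok, hod, -⟩ := exists_orbit_shadowing hσ hρ hf (j m) d
      (Φ.isOrbitOn_iter w _ _ (x m)) (hz.trans_le hrρ)
    exact ⟨o, ho, hok, fun i h h' => (hod i h h').trans_lt hz⟩
  -- The endpoint `z` is left free so that the induction can prescribe where the orbit enters the
  -- next gap.
  have main : ∀ t, 1 ≤ t → t ≤ s → ∀ z, dist z (Φ.iter w (k t) (x t)) < r →
      ∃ y, Φ.iter w (k t) y = z ∧ ∀ m, 1 ≤ m → m ≤ t → ∀ i, j m ≤ i → i ≤ k m →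
        dist (Φ.iter w i y) (Φ.iter w i (x m)) < r := by
    intro t ht
    induction t, ht using Nat.le_induction with
    | base =>
      intro hts z hz
      obtain ⟨o, ho, hok, hod⟩ := pullback 1 le_rfl hts z hz
      have hiter : ∀ i, j 1 ≤ i → i ≤ k 1 → Φ.iter w i (o (j 1)) = o i := fun i h h' =>
        Φ.iter_eq_of_isOrbitOn w ho (by rw [hj1]; rfl) h h'
      refine ⟨o (j 1), (hiter _ (hjk 1 le_rfl hts) le_rfl).trans hok, fun m h1 hm i h h' => ?_⟩
      obtain rfl : m = 1 := le_antisymm hm h1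
      rw [hiter i h h']
      exact hod i h h'
    | succ t ht ih =>
      intro hts z hz
      obtain ⟨o, ho, hok, hod⟩ := pullback (t + 1) (by omega) hts z hz
      have hg := hgap t ht (by omega)
      obtain ⟨d, hd⟩ := Nat.exists_eq_add_of_le (show k t ≤ j (t + 1) by omega)
      -- The bridge `o'` starts within `r` of the end of segment `t` and lands exactly on the start
      -- of the pulled-back segment `o`.
      obtain ⟨o', ho', hoj', hor'⟩ := hexact _ hf (k t) d (by omega) _
        (Φ.isOrbitOn_iter w _ _ (x t)) (o (j (t + 1)))
      rw [← hd] at ho' hoj'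
      obtain ⟨y, hyk, hy⟩ := ih (by omega) (o' (k t)) hor'
      have hyj : Φ.iter w (j (t + 1)) y = o (j (t + 1)) :=
        (Φ.iter_eq_of_isOrbitOn w ho' hyk (by omega) le_rfl).trans hoj'
      have hiter : ∀ i, j (t + 1) ≤ i → i ≤ k (t + 1) → Φ.iter w i y = o i := fun i h h' =>
        Φ.iter_eq_of_isOrbitOn w ho hyj h h'
      refine ⟨y, (hiter _ (hjk _ (by omega) hts) le_rfl).trans hok, fun m h1 hm i h h' => ?_⟩
      rcases Nat.le_succ_iff.1 hm with hm' | rfl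
      · exact hy m h1 hm' i h h'
      · rw [hiter i h h']
        exact hod i h h'
  obtain ⟨y, -, hy⟩ := main s (by omega) le_rfl _ (by rwa [dist_self])
  exact ⟨y, fun m h1 hm i h h' => (hy m h1 hm i h h').le.trans hrδ⟩

end NAIFS

theorem theorem6 {n : ℕ} {M : Type u} [MetricSpace M] [CompactSpace M] [ConnectedSpace M]
    [ChartedSpace (EuclideanSpace ℝ (Fin n)) M] [IsManifold (𝓡 n) ∞ M]
    [Bundle.RiemannianBundle (fun x : M ↦ TangentSpace (𝓡 n) x)]
    [IsContMDiffRiemannianBundle (𝓡 n) ∞ (EuclideanSpace ℝ (Fin n))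
      (fun x : M ↦ TangentSpace (𝓡 n) x)]
    [IsRiemannianManifold (𝓡 n) M]
    (Φ : NAIFS.{u, v} M) (σ ρ : ℝ) (hΦ : Φ.IsUniformlyExpanding n σ ρ) :
    Φ.HasSpecification :=
  Φ.hasSpecification_of_hasExpansionConstants hΦ.1 hΦ.2.1 fun j i => (hΦ.2.2 j i).2
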